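/- Let $N\ge 1$, let $\Omega\subset\mathbb{R}^N$ be a bounded open set, let $2\le p<\infty$, $\alpha,\gamma>0$, and let $\xi_1,\xi_2\in L^\infty(\Omega)\cap BV(\Omega)$ satisfy $\alpha\le\xi_1\le\xi_2$ a.e. in $\Omega$. Let $\mathfrak{A}_{ad}$ be the set of symmetric-matrix-valued functions $A\in L^\infty(\Omega;\mathbb{S}^N)$ such that $$\xi_1^2|\eta|^2\le(\eta,A\eta)_{\mathbb{R}^N}\le\xi_2^2|\eta|^2\quad\text{a.e. in }\Omega,\ \forall\,\eta\in\mathbb{R}^N,\qquad A^{1/2}\in BV(\Omega;\mathbb{S}^N),\qquad \int_\Omega|DA^{1/2}|\le\gamma,$$ where $\int_\Omega|DM|=\sum_{1\le i\le j\le N}\sup\{\int_\Omega m_{ij}\,\mathrm{div}\,\varphi\,dx:\varphi\in C_0^1(\Omega;\mathbb{R}^N),\ |\varphi|\le1\}$ for $M=[m_{ij}]$. For every $k\in\mathbb{N}=\{1,2,\dots\}$ let $\mathcal{F}_k:[0,\infty)\to[0,\infty)$ be a non-decreasing $C^1$ function such that $\mathcal{F}_k(t)=t$ for $0\le t\le k^2$,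 $\mathcal{F}_k(t)=k^2+1$ for $t>k^2+1$, and, for some $\delta\in(0,1)$, $t\le\mathcal{F}_k(t)\le t+\delta$ for $k^2\le t<k^2+1$. For $A\in\mathfrak{A}_{ad}$, $f\in L^2(\Omega)$, $\varepsilon>0$ and $k\in\mathbb{N}$, a function $y\in H_0^1(\Omega)$ is called a weak solution of the regularized boundary value problem $$-\mathrm{div}\Big(\big[\varepsilon+\mathcal{F}_k(|A^{1/2}\nabla y|^2)\big]^{\frac{p-2}{2}}A\nabla y\Big)=f\ \text{ in }\Omega,\qquad y\in H_0^1(\Omega),$$ if $$\int_\Omega\big[\varepsilon+\mathcal{F}_k(|A^{1/2}\nabla y|^2)\big]^{\frac{p-2}{2}}(A\nabla y,\nabla\varphi)_{\mathbb{R}^N}\,dx=\int_\Omega f\varphi\,dx\qquad\forall\,\varphi\in H_0^1(\Omega).$$ Then for every $A\in\mathfrak{A}_{ad}$ and every $f\in L^2(\Omega)$ the weak solutions $y_{\varepsilon,k}=y_{\varepsilon,k}(A,f)$ are uniformly bounded in $H_0^1(\Omega)$: there is a constant $C$, independent of $\varepsilon$ and $k$, such that for all $\varepsilon>0$ and all $k\in\mathbb{N}$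 every weak solution $y_{\varepsilon,k}$ of the regularized problem satisfies $$\|y_{\varepsilon,k}\|_{H^1}=\big(\|y_{\varepsilon,k}\|_{L^2(\Omega)}^2+\|\nabla y_{\varepsilon,k}\|_{L^2(\Omega)^N}^2\big)^{1/2}\le C.$$ -/

import Mathlib

open MeasureTheory
open scoped ENNReal ContDiff MatrixOrder

noncomputable section

namespace AnisotropicPLaplace

/-- The Euclidean space `ℝ^N`. -/
abbrev Eucl (N : ℕ) : Type := EuclideanSpace ℝ (Fin N)

/-- Real `N × N` matrices. -/
abbrev Mat (N : ℕ) : Type := Matrix (Fin N) (Fin N) ℝ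

/-- Lebesgue measure on `Ω`. -/
abbrev vol {N : ℕ} (Ω : Set (Eucl N)) : Measure (Eucl N) := volume.restrict Ω

/-- The product `M v` of a matrix and a vector of `ℝ^N`. -/
def mulV {N : ℕ} (M : Mat N) (v : Eucl N) : Eucl N :=
  WithLp.toLp 2 (M.mulVec (WithLp.ofLp v))

/-! ### The Sobolev space `H₀¹(Ω)` -/

/-- The real test functions `φ ∈ C₀^∞(Ω)`: smooth, with compact support contained in `Ω`. -/
def IsTestFunction {N : ℕ} (Ω : Set (Eucl N)) (φ : Eucl N → ℝ) : Prop :=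
  ContDiff ℝ ∞ φ ∧ HasCompactSupport φ ∧ tsupport φ ⊆ Ω

/-- The Hilbert space `L²(Ω) × L²(Ω; ℝ^N)` with
`‖(u, g)‖² = ‖u‖²_{L²} + ‖g‖²_{L²}`. -/
abbrev L2Pair {N : ℕ} (Ω : Set (Eucl N)) : Type :=
  WithLp 2 (Lp ℝ 2 (vol Ω) × Lp (Eucl N) 2 (vol Ω))

/-- The subspace of all pairs `(φ, ∇φ)` with `φ ∈ C₀^∞(Ω)`. -/
def testPairs {N : ℕ} (Ω : Set (Eucl N)) : Submodule ℝ (L2Pair Ω) where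
  carrier := {u | ∃ φ : Eucl N → ℝ, IsTestFunction Ω φ ∧
    u.fst =ᵐ[vol Ω] φ ∧ u.snd =ᵐ[vol Ω] gradient φ}
  zero_mem' := by
    refine ⟨fun _ => 0, ⟨contDiff_const, HasCompactSupport.zero, ?_⟩, ?_, ?_⟩
    · simp [tsupport]
    · exact Lp.coeFn_zero ℝ 2 (vol Ω)
    · have h : gradient (fun _ : Eucl N => (0 : ℝ)) = 0 := by
        funext x; simp
      rw [h]
      exact Lp.coeFn_zero (Eucl N) 2 (vol Ω)
  add_mem' := by
    rintro u v ⟨φ, ⟨h1, h2, h3⟩, h4, h5⟩ ⟨ψ, ⟨k1, k2, k3⟩, k4, k5⟩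
    refine ⟨φ + ψ, ⟨h1.add k1, h2.add k2, ?_⟩, ?_, ?_⟩
    · exact (tsupport_add φ ψ).trans (Set.union_subset h3 k3)
    · exact (Lp.coeFn_add u.fst v.fst).trans (h4.add k4)
    · have h : gradient (φ + ψ) = gradient φ + gradient ψ := by
        funext x
        simp only [gradient, Pi.add_apply]
        rw [fderiv_add (h1.differentiable (by simp) x) (k1.differentiable (by simp) x), map_add]
      rw [h]
      exact (Lp.coeFn_add u.snd v.snd).trans (h5.add k5)
  smul_mem' := by
    rintro c u ⟨φ, ⟨h1, h2, h3⟩, h4, h5⟩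
    refine ⟨c • φ, ⟨h1.const_smul c, h2.smul_left (f := fun _ => c), ?_⟩, ?_, ?_⟩
    · exact (tsupport_smul_subset_right (fun _ => c) φ).trans h3
    · exact (Lp.coeFn_smul c u.fst).trans (h4.const_smul c)
    · have h : gradient (c • φ) = c • gradient φ := by
        funext x
        simp only [gradient, Pi.smul_apply]
        rw [fderiv_const_smul (h1.differentiable (by simp) x)]
        simp
      rw [h]
      exact (Lp.coeFn_smul c u.snd).trans (h5.const_smul c)

/-- The Sobolev space `H₀¹(Ω)`, the closure of `C₀^∞(Ω)` in the norm
`‖y‖_{H¹} = (‖y‖²_{L²} + ‖∇y‖²_{L²})^{1/2}`. An element `y` is recorded together with its weak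
gradient (which it determines): `y.fst` is the function and `y.snd` is `∇y`. -/
def H10 {N : ℕ} (Ω : Set (Eucl N)) : Submodule ℝ (L2Pair Ω) :=
  (testPairs Ω).topologicalClosure

/-! ### Functions of bounded variation -/

/-- The divergence of a vector field on `ℝ^N`. -/
def divergence {N : ℕ} (Φ : Eucl N → Eucl N) (x : Eucl N) : ℝ :=
  ∑ i, (fderiv ℝ Φ x (EuclideanSpace.single i 1)) i

/-- The vector fields `Φ ∈ C₀¹(Ω; ℝ^N)` with `|Φ| ≤ 1`. -/
def IsUnitField {N : ℕ} (Ω : Set (Eucl N)) (Φ : Eucl N → Eucl N) : Prop :=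
  ContDiff ℝ 1 Φ ∧ HasCompactSupport Φ ∧ tsupport Φ ⊆ Ω ∧ ∀ x, ‖Φ x‖ ≤ 1

/-- The total variation `∫_Ω |Du| = sup {∫_Ω u div Φ : Φ ∈ C₀¹(Ω; ℝ^N), |Φ| ≤ 1}` in `[0, ∞]`
(the supremum is nonnegative since `Φ = 0` is allowed). -/
def totalVariation {N : ℕ} (Ω : Set (Eucl N)) (u : Eucl N → ℝ) : ℝ≥0∞ :=
  ⨆ (Φ : Eucl N → Eucl N) (_ : IsUnitField Ω Φ),
    ENNReal.ofReal (∫ x, u x * divergence Φ x ∂(vol Ω))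

/-- `u ∈ BV(Ω)`. -/
def MemBV {N : ℕ} (Ω : Set (Eucl N)) (u : Eucl N → ℝ) : Prop :=
  MemLp u 1 (vol Ω) ∧ totalVariation Ω u < ⊤

/-- `∫_Ω |DM| = ∑_{i ≤ j} ∫_Ω |D m_{ij}|` for a symmetric matrix field `M = [m_{ij}]`. -/
def matTotalVariation {N : ℕ} (Ω : Set (Eucl N)) (M : Eucl N → Mat N) : ℝ≥0∞ :=
  ∑ i, ∑ j ∈ Finset.Ici i, totalVariation Ω (fun x => M x i j)

/-! ### Admissible controls -/

/-- The nonnegative square root `A^{1/2}` of a matrix field. -/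
def sqrtField {N : ℕ} (A : Eucl N → Mat N) (x : Eucl N) : Mat N :=
  CFC.sqrt (A x)

/-- The set `𝔄_ad` of admissible controls `A ∈ L^∞(Ω; 𝕊^N)`. -/
structure IsAdmissible {N : ℕ} (Ω : Set (Eucl N)) (ξ₁ ξ₂ : Eucl N → ℝ) (γ : ℝ)
    (A : Eucl N → Mat N) : Prop where
  memLp_top : ∀ i j, MemLp (fun x => A x i j) ⊤ (vol Ω)
  symm : ∀ᵐ x ∂(vol Ω), (A x).IsSymm
  bounds : ∀ᵐ x ∂(vol Ω), ∀ η : Eucl N,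
    ξ₁ x ^ 2 * ‖η‖ ^ 2 ≤ inner ℝ η (mulV (A x) η) ∧
    inner ℝ η (mulV (A x) η) ≤ ξ₂ x ^ 2 * ‖η‖ ^ 2
  sqrt_memBV : ∀ i j, MemBV Ω (fun x => sqrtField A x i j)
  sqrt_variation_le : matTotalVariation Ω (sqrtField A) ≤ ENNReal.ofReal γ

/-! ### The regularized boundary value problem -/

/-- The conditions on the cut-off function `𝓕_k : ℝ₊ → ℝ₊` (its values on negative numbers are
irrelevant). -/
structure IsCutoff (k : ℕ) (F : ℝ → ℝ) : Prop where
  nonneg : ∀ t, 0 ≤ t → 0 ≤ F t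
  mono : MonotoneOn F (Set.Ici 0)
  contDiff : ContDiffOn ℝ 1 F (Set.Ici 0)
  eq_self : ∀ t, 0 ≤ t → t ≤ (k : ℝ) ^ 2 → F t = t
  eq_const : ∀ t, (k : ℝ) ^ 2 + 1 < t → F t = (k : ℝ) ^ 2 + 1
  between : ∃ δ : ℝ, 0 < δ ∧ δ < 1 ∧
    ∀ t, (k : ℝ) ^ 2 ≤ t → t < (k : ℝ) ^ 2 + 1 → t ≤ F t ∧ F t ≤ t + δ

/-- `y ∈ H₀¹(Ω)` is a weak solution of
`-div([ε + F(|A^{1/2}∇y|²)]^{(p-2)/2} A∇y) = f` in `Ω`, `y = 0` on `∂Ω`. -/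
def IsWeakSolution {N : ℕ} (Ω : Set (Eucl N)) (p ε : ℝ) (F : ℝ → ℝ) (A : Eucl N → Mat N)
    (f : Lp ℝ 2 (vol Ω)) (y : H10 Ω) : Prop :=
  ∀ φ : H10 Ω,
    ∫ x, (ε + F (‖mulV (sqrtField A x) (y.1.snd x)‖ ^ 2)) ^ ((p - 2) / 2) *
        inner ℝ (mulV (A x) (y.1.snd x)) (φ.1.snd x) ∂(vol Ω)
      = ∫ x, f x * φ.1.fst x ∂(vol Ω)

end AnisotropicPLaplace

end

/-!
The bound comes from testing the equation with the solution `y` itself. Write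
`s = |A^{1/2}∇y|² = (∇y, A∇y)`. Since `k ≥ 1`, the cut-off satisfies `𝓕_k(s) ≥ 𝓕_k(1) = 1` as soon
as `s ≥ 1`, and as `p ≥ 2` the weight `[ε + 𝓕_k(s)]^{(p-2)/2}` is then at least `1`; so the energy
density dominates `s - 1` for every `ε` and `k` (`IsCutoff.sub_one_le_rpow_mul`). With `s ≥ α²|∇y|²`
this gives `α²‖∇y‖² ≤ |Ω| + ‖f‖ ‖y‖` (`IsWeakSolution.energy_le`), whose constants do not involve
`ε` and `k`. The energy density is integrable because the weight is bounded for each fixed `ε`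
and `k`, so the integrals are genuine.

Friedrichs' inequality `‖y‖ ≤ 2R ‖∇y‖` for `Ω` inside a ball of radius `R`
(`norm_fst_le_of_mem_H10`) is proved for test functions by an integration by parts against one
coordinate function, and passes to the closure `H₀¹(Ω)`. Young's inequality then absorbs the linear
term.
-/

namespace AnisotropicPLaplace

variable {N : ℕ} {Ω : Set (Eucl N)}

/-! ### The Friedrichs inequality -/

lemma IsTestFunction.integrable_sq {φ : Eucl N → ℝ} (hφ : IsTestFunction Ω φ) :
    Integrable fun x => φ x ^ 2 := by
  have hc : Continuous fun x => φ x ^ 2 := hφ.1.continuous.pow 2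
  refine hc.integrable_of_hasCompactSupport (hφ.2.1.mono ?_)
  intro x hx h0
  exact hx (by simp [h0])

lemma IsTestFunction.integrable_coord_mul_mul_fderiv {φ : Eucl N → ℝ} (hφ : IsTestFunction Ω φ)
    (i : Fin N) (e : Eucl N) : Integrable fun x : Eucl N => x i * φ x * fderiv ℝ φ x e := by
  have hci : Continuous fun x : Eucl N => x i := by fun_prop
  have hcde : Continuous fun x => fderiv ℝ φ x e :=
    (hφ.1.continuous_fderiv (by simp)).clm_apply continuous_const
  have hc : Continuous fun x : Eucl N => x i * φ x * fderiv ℝ φ x e :=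
    (hci.mul hφ.1.continuous).mul hcde
  refine hc.integrable_of_hasCompactSupport (hφ.2.1.mono ?_)
  intro x hx h0
  exact hx (by simp [h0])

lemma IsTestFunction.integrable_norm_gradient_sq {φ : Eucl N → ℝ} (hφ : IsTestFunction Ω φ) :
    Integrable fun x => ‖gradient φ x‖ ^ 2 := by
  have hnorm : ∀ x, ‖gradient φ x‖ = ‖fderiv ℝ φ x‖ := fun x => LinearIsometryEquiv.norm_map _ _
  simp_rw [hnorm]
  have hc : Continuous fun x => ‖fderiv ℝ φ x‖ ^ 2 := (hφ.1.continuous_fderiv (by simp)).norm.pow 2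
  refine hc.integrable_of_hasCompactSupport ((hφ.2.1.fderiv (𝕜 := ℝ)).mono ?_)
  intro x hx h0
  exact hx (by simp [h0])

/-- The integral over the whole space of the identity `∂ᵢ(xᵢ φ²) = φ² + 2 xᵢ φ ∂ᵢφ`. -/
lemma IsTestFunction.integral_sq_eq {φ : Eucl N → ℝ} (hφ : IsTestFunction Ω φ) (i : Fin N) :
    ∫ x, φ x ^ 2
      = -2 * ∫ x : Eucl N, x i * φ x * fderiv ℝ φ x (EuclideanSpace.single i 1) := by
  have hdiff : Differentiable ℝ φ := hφ.1.differentiable (by simp)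
  have hci : Continuous fun x : Eucl N => x i := by fun_prop
  have hcoord : ∀ x, HasFDerivAt (fun x : Eucl N => x i)
      (EuclideanSpace.proj i : Eucl N →L[ℝ] ℝ) x := fun x =>
    (EuclideanSpace.proj i : Eucl N →L[ℝ] ℝ).hasFDerivAt
  have hint_sq := hφ.integrable_sq
  have hint_cross := hφ.integrable_coord_mul_mul_fderiv i (EuclideanSpace.single i 1)
  have hderiv : ∀ x, fderiv ℝ (fun x : Eucl N => x i * φ x) x (EuclideanSpace.single i 1) * φ x
      = φ x ^ 2 + x i * φ x * fderiv ℝ φ x (EuclideanSpace.single i 1) := by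
    intro x
    have h : HasFDerivAt (fun x : Eucl N => x i * φ x) _ x := (hcoord x).mul (hdiff x).hasFDerivAt
    rw [h.fderiv]
    simp
    ring
  have hparts : ∫ x : Eucl N, x i * φ x * fderiv ℝ φ x (EuclideanSpace.single i 1)
      = -∫ x, fderiv ℝ (fun x : Eucl N => x i * φ x) x (EuclideanSpace.single i 1) * φ x := by
    apply integral_mul_fderiv_eq_neg_fderiv_mul_of_integrable
    · simp_rw [hderiv]
      exact hint_sq.add hint_cross
    · exact hint_cross
    · have hc : Continuous fun x : Eucl N => x i * φ x * φ x :=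
        (hci.mul hφ.1.continuous).mul hφ.1.continuous
      exact hc.integrable_of_hasCompactSupport hφ.2.1.mul_left
    · exact fun x _ => (hcoord x).differentiableAt.mul (hdiff x)
    · exact fun x _ => hdiff x
  simp_rw [hderiv] at hparts
  rw [integral_add hint_sq hint_cross] at hparts
  linarith

/-- Friedrichs' inequality for a test function supported in a slab `|xᵢ| ≤ R`. -/
lemma IsTestFunction.integral_sq_le {φ : Eucl N → ℝ} (hφ : IsTestFunction Ω φ) (i : Fin N)
    {R : ℝ} (hR : ∀ x ∈ Ω, |x i| ≤ R) :
    ∫ x, φ x ^ 2 ≤ 4 * R ^ 2 * ∫ x, ‖gradient φ x‖ ^ 2 := by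
  have hint_sq := hφ.integrable_sq
  have hint_grad := hφ.integrable_norm_gradient_sq
  have hpoint : ∀ x : Eucl N, -2 * (x i * φ x * fderiv ℝ φ x (EuclideanSpace.single i 1))
      ≤ (1 / 2) * φ x ^ 2 + 2 * R ^ 2 * ‖gradient φ x‖ ^ 2 := by
    intro x
    by_cases hx : φ x = 0
    · rw [hx, mul_zero, zero_mul, mul_zero]
      positivity
    have hxR : x i ^ 2 ≤ R ^ 2 :=
      sq_le_sq.2 ((hR x (hφ.2.2 (subset_tsupport φ hx))).trans (le_abs_self R))
    have hpartial : fderiv ℝ φ x (EuclideanSpace.single i 1) ^ 2 ≤ ‖gradient φ x‖ ^ 2 := by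
      have h := (fderiv ℝ φ x).le_opNorm (EuclideanSpace.single i 1)
      rw [PiLp.norm_single, norm_one, mul_one] at h
      have hnorm : ‖gradient φ x‖ = ‖fderiv ℝ φ x‖ := LinearIsometryEquiv.norm_map _ _
      rw [hnorm]
      exact sq_le_sq.2 (h.trans (le_abs_self _))
    generalize fderiv ℝ φ x (EuclideanSpace.single i 1) = d at hpartial ⊢
    have := mul_le_mul hxR hpartial (sq_nonneg _) (sq_nonneg R)
    nlinarith only [this, sq_nonneg (φ x + 2 * (x i * d))]
  have hmono := integral_mono
    ((hφ.integrable_coord_mul_mul_fderiv i (EuclideanSpace.single i 1)).const_mul (-2))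
    ((hint_sq.const_mul (1 / 2)).add (hint_grad.const_mul (2 * R ^ 2))) hpoint
  simp only [Pi.add_apply] at hmono
  rw [integral_add (hint_sq.const_mul _) (hint_grad.const_mul _), integral_const_mul,
    integral_const_mul, integral_const_mul, ← hφ.integral_sq_eq] at hmono
  linarith

/-- The squared norm in `L²` as an integral. -/
lemma norm_sq_eq_integral {E : Type*} [NormedAddCommGroup E] [InnerProductSpace ℝ E]
    (g : Lp E 2 (vol Ω)) : ‖g‖ ^ 2 = ∫ x, ‖g x‖ ^ 2 ∂(vol Ω) := by
  rw [← real_inner_self_eq_norm_sq, L2.inner_def]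
  simp_rw [real_inner_self_eq_norm_sq]

/-- Friedrichs' inequality on `H₀¹(Ω)`. -/
lemma norm_fst_le_of_mem_H10 (i : Fin N) {R : ℝ} (hR0 : 0 ≤ R) (hR : ∀ x ∈ Ω, |x i| ≤ R)
    (y : H10 Ω) : ‖y.1.fst‖ ≤ 2 * R * ‖y.1.snd‖ := by
  have hclosed : IsClosed {u : L2Pair Ω | ‖u.fst‖ ≤ 2 * R * ‖u.snd‖} :=
    isClosed_le (by fun_prop) (by fun_prop)
  refine closure_minimal ?_ hclosed y.2
  rintro u ⟨φ, hφ, hfst, hsnd⟩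
  have h1 : ‖u.fst‖ ^ 2 = ∫ x, φ x ^ 2 := by
    calc ‖u.fst‖ ^ 2 = ∫ x in Ω, φ x ^ 2 := by
          rw [norm_sq_eq_integral]
          refine integral_congr_ae ?_
          filter_upwards [hfst] with x hx
          simp [hx]
      _ = ∫ x, φ x ^ 2 := by
          refine setIntegral_eq_integral_of_forall_compl_eq_zero fun x hx => ?_
          simp [image_eq_zero_of_notMem_tsupport fun h => hx (hφ.2.2 h)]
  have h2 : ‖u.snd‖ ^ 2 = ∫ x, ‖gradient φ x‖ ^ 2 := by
    calc ‖u.snd‖ ^ 2 = ∫ x in Ω, ‖gradient φ x‖ ^ 2 := by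
          rw [norm_sq_eq_integral]
          refine integral_congr_ae ?_
          filter_upwards [hsnd] with x hx
          simp [hx]
      _ = ∫ x, ‖gradient φ x‖ ^ 2 := by
          refine setIntegral_eq_integral_of_forall_compl_eq_zero fun x hx => ?_
          have : fderiv ℝ φ x = 0 := by
            by_contra h
            exact hx (hφ.2.2 (support_fderiv_subset ℝ h))
          simp [gradient, this]
  have h := hφ.integral_sq_le i hR
  rw [← h1, ← h2] at h
  refine (sq_le_sq₀ (norm_nonneg _) (by positivity)).1 ?_
  calc ‖u.fst‖ ^ 2 ≤ 4 * R ^ 2 * ‖u.snd‖ ^ 2 := h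
    _ = (2 * R * ‖u.snd‖) ^ 2 := by ring

/-! ### The coefficient matrix and its square root -/

lemma inner_mulV (M : Mat N) (v w : Eucl N) :
    inner ℝ v (mulV M w) = (WithLp.ofLp v) ⬝ᵥ M.mulVec (WithLp.ofLp w) := by
  simp [mulV, EuclideanSpace.inner_eq_star_dotProduct, dotProduct_comm]

/-- `|A^{1/2} v|² = (v, A v)` for a positive semidefinite matrix `A`. -/
lemma norm_sq_mulV_sqrt {M : Mat N} (hsymm : M.IsSymm)
    (hM : ∀ v : Eucl N, 0 ≤ inner ℝ v (mulV M v)) (v : Eucl N) :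
    ‖mulV (CFC.sqrt M) v‖ ^ 2 = inner ℝ v (mulV M v) := by
  have hpos : M.PosSemidef := by
    refine .of_dotProduct_mulVec_nonneg (Matrix.isHermitian_iff_isSymm.2 hsymm) fun w => ?_
    have := hM (WithLp.toLp 2 w)
    rw [inner_mulV] at this
    simpa using this
  have hsq : CFC.sqrt M * CFC.sqrt M = M := CFC.sqrt_mul_sqrt_self M hpos.nonneg
  have hherm : (CFC.sqrt M).transpose = CFC.sqrt M :=
    Matrix.isHermitian_iff_isSymm.1
      (Matrix.nonneg_iff_posSemidef.1 (CFC.sqrt_nonneg M)).isHermitian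
  rw [← real_inner_self_eq_norm_sq, inner_mulV, inner_mulV]
  conv_rhs => rw [← hsq, ← Matrix.mulVec_mulVec, Matrix.dotProduct_mulVec,
    ← Matrix.mulVec_transpose, hherm]
  rfl

lemma aestronglyMeasurable_mulV {μ : Measure (Eucl N)} {M : Eucl N → Mat N} {v : Eucl N → Eucl N}
    (hM : ∀ i j, AEStronglyMeasurable (fun x => M x i j) μ) (hv : AEStronglyMeasurable v μ) :
    AEStronglyMeasurable (fun x => mulV (M x) (v x)) μ := by
  refine (PiLp.continuous_toLp 2 _).comp_aestronglyMeasurable ?_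
  refine AEMeasurable.aestronglyMeasurable (aemeasurable_pi_lambda _ fun i => ?_)
  simp only [Matrix.mulVec, dotProduct]
  refine Finset.aemeasurable_fun_sum _ fun j _ => (hM i j).aemeasurable.mul ?_
  exact (((EuclideanSpace.proj j : Eucl N →L[ℝ] ℝ).continuous).comp_aestronglyMeasurable
    hv).aemeasurable

/-! ### The cut-off functions -/

lemma IsCutoff.one_le {k : ℕ} {F : ℝ → ℝ} (hF : IsCutoff k F) (hk : 1 ≤ k) {t : ℝ} (ht : 1 ≤ t) :
    1 ≤ F t := by
  have hk' : (1 : ℝ) ≤ (k : ℝ) ^ 2 := one_le_pow₀ (by exact_mod_cast hk)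
  calc (1 : ℝ) = F 1 := (hF.eq_self 1 zero_le_one hk').symm
    _ ≤ F t := hF.mono (by simp) (Set.mem_Ici.2 (by linarith)) ht

lemma IsCutoff.le {k : ℕ} {F : ℝ → ℝ} (hF : IsCutoff k F) {t : ℝ} (ht : 0 ≤ t) :
    F t ≤ (k : ℝ) ^ 2 + 1 := by
  have hmax : (k : ℝ) ^ 2 + 1 < max t ((k : ℝ) ^ 2 + 2) := lt_max_of_lt_right (by linarith)
  rw [← hF.eq_const _ hmax]
  exact hF.mono ht (ht.trans (le_max_left _ _)) (le_max_left _ _)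

/-- The weight `[ε + F(s)]^q` degenerates at most where `s` is small: `s - 1` bounds the energy
density `[ε + F(s)]^q s` from below, whatever `ε` and `k` are. -/
lemma IsCutoff.sub_one_le_rpow_mul {k : ℕ} {F : ℝ → ℝ} (hF : IsCutoff k F) (hk : 1 ≤ k)
    {ε q s : ℝ} (hε : 0 < ε) (hq : 0 ≤ q) (hs : 0 ≤ s) :
    s - 1 ≤ (ε + F s) ^ q * s := by
  have hbase : 0 ≤ ε + F s := add_nonneg hε.le (hF.nonneg s hs)
  rcases le_total s 1 with h | h
  · have := mul_nonneg (Real.rpow_nonneg hbase q) hs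
    linarith
  · have h1 : 1 ≤ (ε + F s) ^ q :=
      Real.one_le_rpow (by linarith [hF.one_le hk h]) hq
    nlinarith

/-! ### The energy estimate -/

variable {ξ₁ ξ₂ : Eucl N → ℝ} {γ : ℝ} {A : Eucl N → Mat N}

/-- The energy density is integrable because the cut-off keeps the weight bounded (by a bound
depending on `k`). -/
lemma integrable_energyDensity (hA : IsAdmissible Ω ξ₁ ξ₂ γ A) (hξ₂ : MemLp ξ₂ ∞ (vol Ω))
    {p ε : ℝ} (hp : 2 ≤ p) (hε : 0 < ε) {k : ℕ} {F : ℝ → ℝ} (hF : IsCutoff k F)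
    (g : Lp (Eucl N) 2 (vol Ω)) :
    Integrable (fun x => (ε + F (‖mulV (sqrtField A x) (g x)‖ ^ 2)) ^ ((p - 2) / 2) *
      inner ℝ (mulV (A x) (g x)) (g x)) (vol Ω) := by
  have hg : AEStronglyMeasurable g (vol Ω) := Lp.aestronglyMeasurable g
  have hq : 0 ≤ (p - 2) / 2 := by linarith
  obtain ⟨M, hM⟩ : ∃ M : ℝ, ∀ᵐ x ∂(vol Ω), ‖ξ₂ x‖ ≤ M :=
    ⟨_, ae_le_lpNorm_exponent_top hξ₂⟩
  have hgint : Integrable (fun x => ‖g x‖ ^ 2) (vol Ω) :=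
    (Lp.memLp g).integrable_norm_pow (by simp)
  refine (hgint.const_mul ((ε + ((k : ℝ) ^ 2 + 1)) ^ ((p - 2) / 2) * M ^ 2)).mono' ?_ ?_
  · have hs : AEMeasurable (fun x => ‖mulV (sqrtField A x) (g x)‖ ^ 2) (vol Ω) :=
      ((aestronglyMeasurable_mulV (fun i j => (hA.sqrt_memBV i j).1.aestronglyMeasurable)
        hg).aemeasurable.norm).pow_const 2
    -- `F` is monotone only on `[0, ∞)`, so it is replaced by `t ↦ F (max t 0)`.
    have hFmono : Monotone fun t => F (max t 0) := fun a b hab =>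
      hF.mono (Set.mem_Ici.2 (le_max_right _ _)) (Set.mem_Ici.2 (le_max_right _ _))
        (max_le_max_right 0 hab)
    have hFs : AEMeasurable (fun x => F (‖mulV (sqrtField A x) (g x)‖ ^ 2)) (vol Ω) := by
      refine (hFmono.measurable.comp_aemeasurable hs).congr (.of_forall fun x => ?_)
      simp only [Function.comp_apply, max_eq_left (sq_nonneg _)]
    refine AEStronglyMeasurable.mul ?_
      ((aestronglyMeasurable_mulV (fun i j => (hA.memLp_top i j).1) hg).inner hg)
    exact ((hFs.const_add ε).pow_const _).aestronglyMeasurable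
  · filter_upwards [hM, hA.bounds] with x hMx hAx
    have hnonneg : 0 ≤ inner ℝ (g x) (mulV (A x) (g x)) :=
      (mul_nonneg (sq_nonneg _) (sq_nonneg _)).trans (hAx (g x)).1
    have hbase : 0 ≤ ε + F (‖mulV (sqrtField A x) (g x)‖ ^ 2) :=
      add_nonneg hε.le (hF.nonneg _ (sq_nonneg _))
    have hMsq : ξ₂ x ^ 2 ≤ M ^ 2 := by
      rw [← sq_abs (ξ₂ x)]
      exact pow_le_pow_left₀ (abs_nonneg _) hMx 2
    rw [real_inner_comm, Real.norm_of_nonneg (mul_nonneg (Real.rpow_nonneg hbase _) hnonneg),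
      mul_assoc]
    refine mul_le_mul ?_ ?_ hnonneg (by positivity)
    · exact Real.rpow_le_rpow hbase (add_le_add_right (hF.le (sq_nonneg _)) ε) hq
    · exact (hAx (g x)).2.trans (mul_le_mul_of_nonneg_right hMsq (sq_nonneg _))

/-- The a priori estimate obtained by testing the equation with the solution itself. -/
lemma IsWeakSolution.energy_le (hΩ_bdd : Bornology.IsBounded Ω)
    (hA : IsAdmissible Ω ξ₁ ξ₂ γ A) (hξ₂ : MemLp ξ₂ ∞ (vol Ω))
    {α : ℝ} (hα : 0 < α) (hξ₁ : ∀ᵐ x ∂(vol Ω), α ≤ ξ₁ x)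
    {p ε : ℝ} (hp : 2 ≤ p) (hε : 0 < ε) {k : ℕ} (hk : 1 ≤ k) {F : ℝ → ℝ} (hF : IsCutoff k F)
    {f : Lp ℝ 2 (vol Ω)} {y : H10 Ω} (hy : IsWeakSolution Ω p ε F A f y) :
    α ^ 2 * ‖y.1.snd‖ ^ 2 ≤ volume.real Ω + ‖f‖ * ‖y.1.fst‖ := by
  have : IsFiniteMeasure (vol Ω) :=
    isFiniteMeasure_restrict.2 hΩ_bdd.measure_lt_top.ne
  set g := y.1.snd
  have hgint : Integrable (fun x => ‖g x‖ ^ 2) (vol Ω) :=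
    (Lp.memLp g).integrable_norm_pow (by simp)
  have hlower : ∫ x, (α ^ 2 * ‖g x‖ ^ 2 - 1) ∂(vol Ω)
      ≤ ∫ x, (ε + F (‖mulV (sqrtField A x) (g x)‖ ^ 2)) ^ ((p - 2) / 2) *
        inner ℝ (mulV (A x) (g x)) (g x) ∂(vol Ω) := by
    refine integral_mono_ae ((hgint.const_mul _).sub (integrable_const 1))
      (integrable_energyDensity hA hξ₂ hp hε hF g) ?_
    filter_upwards [hξ₁, hA.bounds, hA.symm] with x hαx hAx hsx
    have hnonneg : ∀ v : Eucl N, 0 ≤ inner ℝ v (mulV (A x) v) := fun v =>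
      (mul_nonneg (sq_nonneg _) (sq_nonneg _)).trans (hAx v).1
    have hcoer : α ^ 2 * ‖g x‖ ^ 2 ≤ inner ℝ (g x) (mulV (A x) (g x)) :=
      (mul_le_mul_of_nonneg_right (pow_le_pow_left₀ hα.le hαx 2) (sq_nonneg _)).trans
        (hAx (g x)).1
    have hsqrt : ‖mulV (sqrtField A x) (g x)‖ ^ 2 = inner ℝ (g x) (mulV (A x) (g x)) :=
      norm_sq_mulV_sqrt hsx hnonneg (g x)
    have := hF.sub_one_le_rpow_mul hk (q := (p - 2) / 2) hε (by linarith) (hnonneg (g x))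
    simp only [hsqrt, real_inner_comm (g x)]
    linarith
  have hload : ∫ x, f x * y.1.fst x ∂(vol Ω) ≤ ‖f‖ * ‖y.1.fst‖ := by
    have h : inner ℝ f y.1.fst = ∫ x, f x * y.1.fst x ∂(vol Ω) := by
      rw [L2.inner_def]
      simp [mul_comm]
    rw [← h]
    exact real_inner_le_norm _ _
  rw [hy y, integral_sub (hgint.const_mul _) (integrable_const 1), integral_const_mul,
    ← norm_sq_eq_integral] at hlower
  simp only [integral_const, smul_eq_mul, mul_one, measureReal_restrict_apply_univ] at hlower
  linarith

end AnisotropicPLaplace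

/-! ### The uniform bound -/
theorem mainTheorem5 {N : ℕ} (hN : 1 ≤ N)
    (Ω : Set (AnisotropicPLaplace.Eucl N)) (hΩ_open : IsOpen Ω)
    (hΩ_bdd : Bornology.IsBounded Ω)
    (p : ℝ) (hp : 2 ≤ p)
    (α γ : ℝ) (hα : 0 < α) (hγ : 0 < γ)
    (ξ₁ ξ₂ : AnisotropicPLaplace.Eucl N → ℝ)
    (hξ₁_bdd : MemLp ξ₁ ∞ (AnisotropicPLaplace.vol Ω)) (hξ₁_BV : AnisotropicPLaplace.MemBV Ω ξ₁)
    (hξ₂_bdd : MemLp ξ₂ ∞ (AnisotropicPLaplace.vol Ω)) (hξ₂_BV : AnisotropicPLaplace.MemBV Ω ξ₂)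
    (hξ : ∀ᵐ x ∂(AnisotropicPLaplace.vol Ω), α ≤ ξ₁ x ∧ ξ₁ x ≤ ξ₂ x)
    (𝓕 : ℕ → ℝ → ℝ) (h𝓕 : ∀ k, 1 ≤ k → AnisotropicPLaplace.IsCutoff k (𝓕 k))
    (A : AnisotropicPLaplace.Eucl N → AnisotropicPLaplace.Mat N)
    (hA : AnisotropicPLaplace.IsAdmissible Ω ξ₁ ξ₂ γ A)
    (f : Lp ℝ 2 (AnisotropicPLaplace.vol Ω)) :
    ∃ C : ℝ, ∀ ε : ℝ, 0 < ε → ∀ k : ℕ, 1 ≤ k → ∀ y : AnisotropicPLaplace.H10 Ω,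
      AnisotropicPLaplace.IsWeakSolution Ω p ε (𝓕 k) A f y → ‖y‖ ≤ C := by
  obtain ⟨R, hR0, hR⟩ := hΩ_bdd.exists_pos_norm_le
  let i : Fin N := ⟨0, hN⟩
  have hcoord : ∀ x ∈ Ω, |x i| ≤ R := fun x hx => (PiLp.norm_apply_le x i).trans (hR x hx)
  set V := volume.real Ω
  -- Young's inequality absorbs `2 R ‖f‖ ‖∇y‖` into half of `α² ‖∇y‖²`.
  refine ⟨√(((2 * R) ^ 2 + 1) * ((2 * V + (‖f‖ * (2 * R) / α) ^ 2) / α ^ 2)), ?_⟩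
  intro ε hε k hk y hy
  have hfst := AnisotropicPLaplace.norm_fst_le_of_mem_H10 i hR0.le hcoord y
  have henergy := hy.energy_le hΩ_bdd hA hξ₂_bdd hα (hξ.mono fun _ h => h.1) hp hε hk (h𝓕 k hk)
  have hload := mul_le_mul_of_nonneg_left hfst (norm_nonneg f)
  have hgrad : ‖y.1.snd‖ ^ 2 ≤ (2 * V + (‖f‖ * (2 * R) / α) ^ 2) / α ^ 2 := by
    rw [le_div_iff₀ (by positivity)]
    have hyoung := two_mul_le_add_sq (‖f‖ * (2 * R) / α) (α * ‖y.1.snd‖)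
    have hcancel : 2 * (‖f‖ * (2 * R) / α) * (α * ‖y.1.snd‖)
        = 2 * (‖f‖ * (2 * R * ‖y.1.snd‖)) := by
      field_simp
    rw [hcancel, mul_pow] at hyoung
    linarith
  refine Real.le_sqrt_of_sq_le ?_
  calc ‖y‖ ^ 2 = ‖y.1.fst‖ ^ 2 + ‖y.1.snd‖ ^ 2 := WithLp.prod_norm_sq_eq_of_L2 y.1
    _ ≤ (2 * R * ‖y.1.snd‖) ^ 2 + ‖y.1.snd‖ ^ 2 := by gcongr
    _ = ((2 * R) ^ 2 + 1) * ‖y.1.snd‖ ^ 2 := by ring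
    _ ≤ _ := by gcongr
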